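/- Let $F_n = 2^{2^n}+1$ ($n \ge 0$) denote the Fermat numbers. A prime $p$ is called elite if all sufficiently large Fermat numbers are quadratic nonresidues modulo $p$, that is, if there is an $N$ such that for every $n \ge N$ the number $F_n$ is not congruent to a square modulo $p$. Let $E(x)$ be the number of elite primes $p \le x$. Then, unconditionally, $$E(x) = O\left(\frac{x}{(\log x)^{3/2}}\right) \quad \text{as } x \to \infty.$$ Moreover, the sum $\sum_{p \text{ elite}} \frac{1}{p}$ of the reciprocals of the elite primes converges. -/

import Mathlib

open Filter Asymptotics

/-- A prime `p` is elite if all sufficiently large Fermat numbers `2 ^ (2 ^ n) + 1` are quadratic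
nonresidues modulo `p`, i.e. are not congruent to a square modulo `p`. -/
def IsElitePrime (p : ℕ) : Prop :=
  p.Prime ∧ ∀ᶠ n : ℕ in atTop, ¬ IsSquare ((Nat.fermatNumber n : ℕ) : ZMod p)

/-- The number of elite primes up to `x`. -/
noncomputable def eliteCount (x : ℝ) : ℕ :=
  {p : ℕ | IsElitePrime p ∧ (p : ℝ) ≤ x}.ncard

/-! Modulo an odd prime `p`, the sequence $F_n$ is purely periodic from the index $v_2(p-1)$ on, so
for elite `p` every such $F_n$ is a nonresidue, not just the distant ones. Fix $e \ge 1$. Either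
$2^e \mid p-1$, which is one reduced class among $2^{e-1}$, or $F_n$ is a nonresidue modulo `p` for
all $n \ge e$. In the second case reciprocity ($F_n \equiv 1 \bmod 4$) makes the Jacobi symbol
$(p/F_n)$ equal to $-1$. For $e \le n < N$ each condition leaves at most half of the reduced classes
modulo $F_n$; since Fermat numbers are pairwise coprime, a proportion at most $2^{-(N-e)}$ of the
reduced classes modulo $F_e \cdots F_{N-1}$ survives (`exists_residues`).

Brun–Titchmarsh (`card_primes_modEq_le`, from `selberg_sieve`) bounds the primes in each class. With
$N = 2e$ and $4^e \asymp \log x$ the modulus is a small power of $x$, and both cases contribute $O(x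
/ (2^e \log x)) = O(x/(\log x)^{3/2})$. The exponent exceeds 1, so dyadic summation gives
convergence. -/

/-! ### Selberg's sieve -/

open ArithmeticFunction in
/-- The sum of the Möbius function over the divisors of a squarefree `j` that are multiples of
`k`. -/
theorem sum_moebius_between {j k : ℕ} (hj : Squarefree j) :
    ∑ d ∈ j.divisors with k ∣ d, (moebius d : ℝ) = if k = j then (moebius j : ℝ) else 0 := by
  by_cases hkj : k ∣ j
  · obtain ⟨e, rfl⟩ := hkj
    have hk0 : k ≠ 0 := left_ne_zero_of_mul hj.ne_zero
    have he0 : e ≠ 0 := right_ne_zero_of_mul hj.ne_zero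
    have hco : k.Coprime e := Nat.coprime_of_squarefree_mul hj
    have himg : ((k * e).divisors.filter (k ∣ ·)) = e.divisors.image (k * ·) := by
      ext d
      simp only [Finset.mem_filter, Nat.mem_divisors, Finset.mem_image]
      constructor
      · rintro ⟨⟨h1, h2⟩, c, rfl⟩
        exact ⟨c, ⟨Nat.dvd_of_mul_dvd_mul_left (Nat.pos_of_ne_zero hk0) h1, he0⟩, rfl⟩
      · rintro ⟨c, ⟨h1, h2⟩, rfl⟩
        exact ⟨⟨Nat.mul_dvd_mul_left k h1, mul_ne_zero hk0 he0⟩, Dvd.intro c rfl⟩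
    rw [himg, Finset.sum_image (fun a _ b _ h => Nat.eq_of_mul_eq_mul_left
      (Nat.pos_of_ne_zero hk0) h)]
    have h1 : ∑ c ∈ e.divisors, (moebius (k * c) : ℝ)
        = (moebius k : ℝ) * ∑ c ∈ e.divisors, (moebius c : ℝ) := by
      rw [Finset.mul_sum]
      refine Finset.sum_congr rfl fun c hc => ?_
      have : k.Coprime c := hco.coprime_dvd_right (Nat.dvd_of_mem_divisors hc)
      rw [isMultiplicative_moebius.map_mul_of_coprime this]
      push_cast; ring
    have h2 : ∑ c ∈ e.divisors, (moebius c : ℝ) = if e = 1 then 1 else 0 := by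
      have := congrArg (fun f : ArithmeticFunction ℤ => f e) moebius_mul_coe_zeta
      simp only [coe_mul_zeta_apply, one_apply] at this
      exact_mod_cast this
    rw [h1, h2]
    by_cases he : e = 1
    · simp [he]
    · have : k ≠ k * e := fun h => he (by
        have : k * 1 = k * e := by omega
        exact (Nat.eq_of_mul_eq_mul_left (Nat.pos_of_ne_zero hk0) this).symm)
      simp [he, this]
  · have : k ≠ j := fun h => hkj (h ▸ dvd_rfl)
    rw [if_neg this, Finset.filter_false_of_mem, Finset.sum_empty]
    intro d hd hkd
    exact hkj (hkd.trans (Nat.dvd_of_mem_divisors hd))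

open ArithmeticFunction in
/-- **Selberg's sieve**: an upper bound for the number of elements of `A` that are not divisible by
any element of `D` other than `1`, where `D` is a divisor-closed set of squarefree numbers. -/
theorem selberg_sieve (D A : Finset ℕ) (hsq : ∀ d ∈ D, Squarefree d)
    (hdvd : ∀ d ∈ D, ∀ k, k ∣ d → k ∈ D) (h1 : 1 ∈ D) (X K : ℝ)
    (hA : ∀ d₁ ∈ D, ∀ d₂ ∈ D,
      |((A.filter (Nat.lcm d₁ d₂ ∣ ·)).card : ℝ) - X / (Nat.lcm d₁ d₂ : ℕ)| ≤ K) :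
    ((A.filter (fun n => ∀ d ∈ D, d ∣ n → d = 1)).card : ℝ) ≤
      X / (∑ d ∈ D, 1 / (d.totient : ℝ)) + K * (∑ d ∈ D, (d : ℝ)) ^ 2 := by
  set S : ℝ := ∑ d ∈ D, 1 / (d.totient : ℝ) with hS
  -- The weights `w` are Selberg's optimal ones: under `w 1 = 1` they minimise the quadratic form
  -- evaluated in `hquad`.
  set T : ℕ → ℝ := fun d => ∑ k ∈ D with d ∣ k, 1 / (k.totient : ℝ) with hT
  set w : ℕ → ℝ := fun d => d * moebius d * T d / S with hw
  have hpos : ∀ d ∈ D, 0 < d := fun d hd => Nat.pos_of_ne_zero (hsq d hd).ne_zero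
  have hφ : ∀ d ∈ D, (0 : ℝ) < d.totient := fun d hd => by
    exact_mod_cast Nat.totient_pos.mpr (hpos d hd)
  have hSpos : 0 < S := Finset.sum_pos (fun d hd => one_div_pos.mpr (hφ d hd)) ⟨1, h1⟩
  have hT0 : ∀ d, 0 ≤ T d := fun d => Finset.sum_nonneg fun k _ => by positivity
  have hTS : ∀ d, T d ≤ S := fun d =>
    Finset.sum_le_sum_of_subset_of_nonneg (Finset.filter_subset _ _) fun k _ _ => by positivity
  have hw1 : w 1 = 1 := by
    have : T 1 = S := by simp [hT, hS]
    simp [hw, this, hSpos.ne']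
  have hwabs : ∀ d ∈ D, |w d| ≤ d := by
    intro d _
    have hμ : |(moebius d : ℝ)| ≤ 1 := by exact_mod_cast abs_moebius_le_one (n := d)
    have : w d = d * moebius d * (T d / S) := by simp only [hw]; ring
    rw [this, abs_mul, abs_mul, Nat.abs_cast, abs_of_nonneg (div_nonneg (hT0 d) hSpos.le)]
    have h2 : T d / S ≤ 1 := (div_le_one hSpos).mpr (hTS d)
    calc (d : ℝ) * |(moebius d : ℝ)| * (T d / S) ≤ d * 1 * 1 := by
          gcongr
      _ = d := by ring
  have hu : ∀ k ∈ D, ∑ d ∈ D with k ∣ d, w d / d = moebius k / (k.totient * S) := by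
    intro k hk
    have e1 : ∑ d ∈ D with k ∣ d, w d / d
        = (∑ j ∈ D, 1 / (j.totient : ℝ) * ∑ d ∈ j.divisors with k ∣ d, (moebius d : ℝ)) / S := by
      have a1 : ∀ d ∈ D.filter (k ∣ ·), w d / d
          = (∑ j ∈ D, if d ∣ j then 1 / (j.totient : ℝ) * (moebius d : ℝ) else 0) / S := by
        intro d hd
        have hd0 : (d : ℝ) ≠ 0 := by
          exact_mod_cast (hpos d (Finset.mem_filter.mp hd).1).ne'
        rw [← Finset.sum_filter, ← Finset.sum_mul]
        simp only [hw, hT]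
        field_simp
      rw [Finset.sum_congr rfl a1, ← Finset.sum_div, Finset.sum_comm]
      congr 1
      refine Finset.sum_congr rfl fun j hj => ?_
      rw [← Finset.sum_filter, Finset.mul_sum]
      refine Finset.sum_congr ?_ fun _ _ => rfl
      ext d
      simp only [Finset.mem_filter, Nat.mem_divisors]
      exact ⟨fun h => ⟨⟨h.2, (hpos j hj).ne'⟩, h.1.2⟩, fun h => ⟨⟨hdvd j hj d h.1.1, h.2⟩, h.1.1⟩⟩
    rw [e1, Finset.sum_congr rfl fun j hj => by rw [sum_moebius_between (hsq j hj)]]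
    simp only [mul_ite, mul_zero]
    rw [Finset.sum_ite_eq, if_pos hk]
    field_simp
  -- Since $1/\mathrm{lcm} = \gcd/(d_1 d_2)$ and $\gcd = \sum_{k \mid \gcd} \varphi(k)$, the form is
  -- diagonal in the sums computed in `hu`.
  have hquad : ∑ d₁ ∈ D, ∑ d₂ ∈ D, w d₁ * w d₂ / (Nat.lcm d₁ d₂ : ℕ) = 1 / S := by
    have a1 : ∀ d₁ ∈ D, ∀ d₂ ∈ D, w d₁ * w d₂ / (Nat.lcm d₁ d₂ : ℕ)
        = ∑ k ∈ D, (k.totient : ℝ) * ((if k ∣ d₁ then w d₁ / d₁ else 0) *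
            (if k ∣ d₂ then w d₂ / d₂ else 0)) := by
      intro d₁ hd₁ d₂ hd₂
      have hg : ((Nat.gcd d₁ d₂ : ℕ) : ℝ) = ∑ k ∈ D with k ∣ d₁ ∧ k ∣ d₂, (k.totient : ℝ) := by
        conv_lhs => rw [← Nat.sum_totient (Nat.gcd d₁ d₂)]
        push_cast
        refine Finset.sum_congr ?_ fun _ _ => rfl
        ext k
        simp only [Finset.mem_filter, Nat.mem_divisors, Nat.dvd_gcd_iff]
        exact ⟨fun h => ⟨hdvd d₁ hd₁ k h.1.1, h.1⟩,
          fun h => ⟨h.2, (Nat.gcd_pos_of_pos_left _ (hpos d₁ hd₁)).ne'⟩⟩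
      have hgl : ((Nat.gcd d₁ d₂ : ℕ) : ℝ) * (Nat.lcm d₁ d₂ : ℕ) = d₁ * d₂ := by
        exact_mod_cast Nat.gcd_mul_lcm d₁ d₂
      have p1 : (d₁ : ℝ) ≠ 0 := by exact_mod_cast (hpos d₁ hd₁).ne'
      have p2 : (d₂ : ℝ) ≠ 0 := by exact_mod_cast (hpos d₂ hd₂).ne'
      have p3 : ((Nat.lcm d₁ d₂ : ℕ) : ℝ) ≠ 0 := fun h => by
        rw [h, mul_zero] at hgl; exact mul_ne_zero p1 p2 hgl.symm
      have a2 : w d₁ * w d₂ / (Nat.lcm d₁ d₂ : ℕ)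
          = ((Nat.gcd d₁ d₂ : ℕ) : ℝ) * (w d₁ / d₁ * (w d₂ / d₂)) := by
        generalize w d₁ = u, w d₂ = v
        rw [div_mul_div_comm, ← hgl, div_eq_iff p3]
        have p4 : ((Nat.gcd d₁ d₂ : ℕ) : ℝ) ≠ 0 := fun h => by
          rw [h, zero_mul] at hgl; exact mul_ne_zero p1 p2 hgl.symm
        field_simp
      rw [a2, hg, Finset.sum_mul, Finset.sum_filter]
      refine Finset.sum_congr rfl fun k _ => ?_
      by_cases b1 : k ∣ d₁ <;> by_cases b2 : k ∣ d₂ <;> simp [b1, b2]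
    rw [Finset.sum_congr rfl fun d₁ hd₁ => Finset.sum_congr rfl fun d₂ hd₂ => a1 d₁ hd₁ d₂ hd₂]
    rw [Finset.sum_congr rfl fun d₁ _ => Finset.sum_comm, Finset.sum_comm]
    have a3 : ∀ k ∈ D, ∑ d₁ ∈ D, ∑ d₂ ∈ D, (k.totient : ℝ) * ((if k ∣ d₁ then w d₁ / d₁ else 0) *
            (if k ∣ d₂ then w d₂ / d₂ else 0)) = 1 / (k.totient : ℝ) / S ^ 2 := by
      intro k hk
      simp_rw [← Finset.mul_sum]
      rw [← Finset.sum_mul, ← Finset.sum_filter, hu k hk]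
      have hμ : (moebius k : ℝ) ^ 2 = 1 := by
        exact_mod_cast moebius_sq_eq_one_of_squarefree (hsq k hk)
      have := hφ k hk
      field_simp
      linear_combination hμ
    rw [Finset.sum_congr rfl a3, ← Finset.sum_div, ← hS]
    field_simp
  -- The square is nonnegative everywhere and equals 1 at every unsifted `n`.
  have hcard : ((A.filter (fun n => ∀ d ∈ D, d ∣ n → d = 1)).card : ℝ)
      ≤ ∑ n ∈ A, (∑ d ∈ D with d ∣ n, w d) ^ 2 := by
    rw [Finset.card_filter]
    push_cast
    refine Finset.sum_le_sum fun n _ => ?_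
    split_ifs with h
    · have : D.filter (· ∣ n) = {1} := by
        ext d
        simp only [Finset.mem_filter, Finset.mem_singleton]
        exact ⟨fun hd => h d hd.1 hd.2, fun hd => hd ▸ ⟨h1, one_dvd n⟩⟩
      simp [this, hw1]
    · positivity
  have hexp : ∑ n ∈ A, (∑ d ∈ D with d ∣ n, w d) ^ 2
      = ∑ d₁ ∈ D, ∑ d₂ ∈ D, w d₁ * w d₂ * (A.filter (Nat.lcm d₁ d₂ ∣ ·)).card := by
    have a1 : ∀ n, (∑ d ∈ D with d ∣ n, w d) ^ 2
        = ∑ d₁ ∈ D, ∑ d₂ ∈ D, w d₁ * w d₂ * (if Nat.lcm d₁ d₂ ∣ n then 1 else 0) := by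
      intro n
      rw [sq, Finset.sum_filter, Finset.sum_mul_sum]
      refine Finset.sum_congr rfl fun d₁ _ => Finset.sum_congr rfl fun d₂ _ => ?_
      simp only [Nat.lcm_dvd_iff]
      by_cases b1 : d₁ ∣ n <;> by_cases b2 : d₂ ∣ n <;> simp [b1, b2]
    simp_rw [a1]
    rw [Finset.sum_comm]
    refine Finset.sum_congr rfl fun d₁ _ => ?_
    rw [Finset.sum_comm]
    refine Finset.sum_congr rfl fun d₂ _ => ?_
    rw [← Finset.mul_sum, Finset.card_filter]
    push_cast
    rfl
  rw [hexp] at hcard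
  refine hcard.trans ?_
  have hfin : ∀ d₁ ∈ D, ∀ d₂ ∈ D, w d₁ * w d₂ * (A.filter (Nat.lcm d₁ d₂ ∣ ·)).card
      ≤ X * (w d₁ * w d₂ / (Nat.lcm d₁ d₂ : ℕ)) + K * (d₁ * d₂) := by
    intro d₁ hd₁ d₂ hd₂
    have b1 := hA d₁ hd₁ d₂ hd₂
    set c : ℝ := ((A.filter (Nat.lcm d₁ d₂ ∣ ·)).card : ℝ)
    have b2 : |w d₁ * w d₂| ≤ d₁ * d₂ := by
      rw [abs_mul]
      exact mul_le_mul (hwabs d₁ hd₁) (hwabs d₂ hd₂) (abs_nonneg _) (Nat.cast_nonneg _)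
    have b3 : w d₁ * w d₂ * (c - X / (Nat.lcm d₁ d₂ : ℕ)) ≤ K * (d₁ * d₂) := by
      refine (le_abs_self _).trans ?_
      rw [abs_mul, mul_comm]
      exact mul_le_mul b1 b2 (abs_nonneg _) ((abs_nonneg _).trans b1)
    calc w d₁ * w d₂ * c = X * (w d₁ * w d₂ / (Nat.lcm d₁ d₂ : ℕ))
          + w d₁ * w d₂ * (c - X / (Nat.lcm d₁ d₂ : ℕ)) := by ring
      _ ≤ _ := by gcongr
  refine (Finset.sum_le_sum fun d₁ hd₁ => Finset.sum_le_sum fun d₂ hd₂ => hfin d₁ hd₁ d₂ hd₂).trans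
    (le_of_eq ?_)
  simp_rw [Finset.sum_add_distrib, ← Finset.mul_sum]
  rw [hquad, sq, Finset.sum_mul_sum]
  simp_rw [← Finset.mul_sum]
  ring

/-! ### The Brun–Titchmarsh inequality -/

/-- A finite sum of reciprocals of integers composed of primes dividing `N` is at most
`N / φ(N)`. -/
theorem sum_inv_factoredNumbers_le {N : ℕ} (hN : N ≠ 0) (t : Finset ℕ)
    (ht : ∀ m ∈ t, m ∈ Nat.factoredNumbers N.primeFactors) :
    ∑ m ∈ t, (1 / m : ℝ) ≤ N / N.totient := by
  let f : ℕ →* ℝ :=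
    { toFun := fun n => (n : ℝ)⁻¹
      map_one' := by simp
      map_mul' := fun a b => by push_cast; rw [mul_inv] }
  have hf : ∀ {p : ℕ}, p.Prime → ‖f p‖ < 1 := by
    intro p hp
    have : (1 : ℝ) < p := by exact_mod_cast hp.one_lt
    change ‖(p : ℝ)⁻¹‖ < 1
    rw [norm_inv, Real.norm_natCast]
    exact inv_lt_one_of_one_lt₀ this
  have h := (EulerProduct.summable_and_hasSum_factoredNumbers_prod_filter_prime_geometric hf
    N.primeFactors).2
  have hval : ∏ p ∈ N.primeFactors with p.Prime, (1 - f p)⁻¹ = (N : ℝ) / N.totient := by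
    rw [Finset.filter_true_of_mem fun p hp => Nat.prime_of_mem_primeFactors hp]
    have h1 : (N.totient : ℝ) = N * ∏ p ∈ N.primeFactors, (1 - (p : ℝ)⁻¹) := by
      have := Nat.totient_eq_mul_prod_factors N
      have h2 := congrArg (fun x : ℚ => (x : ℝ)) this
      push_cast at h2
      exact h2
    have h3 : (N : ℝ) ≠ 0 := by exact_mod_cast hN
    rw [h1, Finset.prod_inv_distrib, div_mul_cancel_left₀ h3]
    rfl
  rw [hval] at h
  have h4 := sum_le_hasSum (t.subtype (· ∈ Nat.factoredNumbers N.primeFactors))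
    (fun i _ => (inv_nonneg.mpr (Nat.cast_nonneg _) : (0 : ℝ) ≤ f i)) h
  refine le_trans (le_of_eq ?_) h4
  simp only [one_div]
  exact (Finset.sum_subtype_of_mem (fun m : ℕ => (m : ℝ)⁻¹) ht).symm

/-- The squarefree numbers up to `z` that are coprime to `q`. -/
def squarefreeCoprime (q z : ℕ) : Finset ℕ :=
  (Finset.Icc 1 z).filter fun d => Squarefree d ∧ d.Coprime q

theorem mem_squarefreeCoprime {q z d : ℕ} :
    d ∈ squarefreeCoprime q z ↔ (1 ≤ d ∧ d ≤ z) ∧ Squarefree d ∧ d.Coprime q := by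
  simp [squarefreeCoprime]

/-- Group the harmonic sum up to `z` by `d`, the product of the primes dividing `n` but not `q`.
Then $n = dm$ with all primes of $m$ dividing $dq$, so the group of `d` contributes at most
$\frac{1}{d} \cdot \frac{dq}{\varphi(dq)} = \frac{q}{\varphi(q)} \cdot \frac{1}{\varphi(d)}$. -/
theorem log_le_sum_inv_totient {q : ℕ} (hq : q ≠ 0) (z : ℕ) :
    Real.log (z + 1) ≤
      q / q.totient * ∑ d ∈ squarefreeCoprime q z, 1 / (d.totient : ℝ) := by
  have h1 : Real.log (z + 1) ≤ ∑ n ∈ Finset.Icc 1 z, (1 / n : ℝ) := by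
    have := log_add_one_le_harmonic z
    rw [harmonic_eq_sum_Icc] at this
    push_cast at this
    simpa only [one_div] using this
  refine h1.trans ?_
  let f : ℕ → ℕ := fun n => ∏ p ∈ n.primeFactors \ q.primeFactors, p
  have hpr : ∀ n : ℕ, ∀ p ∈ n.primeFactors \ q.primeFactors, p.Prime := fun n p hp =>
    Nat.prime_of_mem_primeFactors (Finset.mem_sdiff.mp hp).1
  have hfd : ∀ n, f n ∣ n := fun n =>
    (Finset.prod_dvd_prod_of_subset _ _ _ Finset.sdiff_subset).trans (Nat.prod_primeFactors_dvd n)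
  have hfpf : ∀ n, (f n).primeFactors = n.primeFactors \ q.primeFactors := fun n =>
    Nat.primeFactors_prod (hpr n)
  have hmaps : ∀ n ∈ Finset.Icc 1 z, f n ∈ squarefreeCoprime q z := by
    intro n hn
    rw [Finset.mem_Icc] at hn
    have hle := Nat.le_of_dvd hn.1 (hfd n)
    have hpos : 0 < f n := Nat.pos_of_dvd_of_pos (hfd n) hn.1
    refine mem_squarefreeCoprime.mpr ⟨⟨hpos, hle.trans hn.2⟩, ?_, ?_⟩
    · refine Finset.squarefree_prod_of_pairwise_isCoprime ?_ fun p hp => (hpr n p hp).squarefree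
      intro a ha b hb hab
      exact Nat.coprime_iff_isRelPrime.mp ((Nat.coprime_primes (hpr n a ha) (hpr n b hb)).mpr hab)
    · refine Nat.Coprime.prod_left fun p hp => ?_
      rw [(hpr n p hp).coprime_iff_not_dvd]
      intro hpq
      exact (Finset.mem_sdiff.mp hp).2 (Nat.mem_primeFactors.mpr ⟨hpr n p hp, hpq, hq⟩)
  rw [← Finset.sum_fiberwise_of_maps_to hmaps, Finset.mul_sum]
  refine Finset.sum_le_sum fun d hd => ?_
  obtain ⟨⟨hd1, hdz⟩, hdsq, hdq⟩ := mem_squarefreeCoprime.mp hd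
  have hd0 : d ≠ 0 := by omega
  have hdR : (d : ℝ) ≠ 0 := by exact_mod_cast hd0
  have hfib : ∀ n ∈ (Finset.Icc 1 z).filter (f · = d), d * (n / d) = n := fun n hn =>
    Nat.mul_div_cancel' ((Finset.mem_filter.mp hn).2 ▸ hfd n)
  have h2 : ∑ n ∈ Finset.Icc 1 z with f n = d, (1 / n : ℝ)
      = 1 / d * ∑ m ∈ ((Finset.Icc 1 z).filter (f · = d)).image (· / d), (1 / m : ℝ) := by
    rw [Finset.sum_image, Finset.mul_sum]
    · refine Finset.sum_congr rfl fun n hn => ?_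
      conv_lhs => rw [← hfib n hn]
      push_cast
      rw [one_div_mul_one_div]
    · intro a ha b hb hab
      rw [← hfib a ha, ← hfib b hb]
      exact congrArg (d * ·) hab
  have h3 := sum_inv_factoredNumbers_le (mul_ne_zero hd0 hq)
    (((Finset.Icc 1 z).filter (f · = d)).image (· / d)) (by
      intro m hm
      obtain ⟨n, hn, rfl⟩ := Finset.mem_image.mp hm
      obtain ⟨hn1, hn2⟩ := Finset.mem_filter.mp hn
      have hn0 : n ≠ 0 := by have := (Finset.mem_Icc.mp hn1).1; omega
      have hm0 : n / d ≠ 0 := fun h0 => hn0 (by rw [← hfib n hn, h0, mul_zero])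
      refine Nat.mem_factoredNumbers_of_primeFactors_subset hm0 ?_
      rw [Nat.primeFactors_mul hd0 hq, ← hn2, hfpf]
      refine (Nat.primeFactors_mono (Nat.div_dvd_of_dvd (hn2 ▸ hfd n)) hn0).trans ?_
      intro p hp
      by_cases h : p ∈ q.primeFactors
      · exact Finset.mem_union_right _ h
      · exact Finset.mem_union_left _ (Finset.mem_sdiff.mpr ⟨hp, h⟩))
  rw [h2]
  refine (mul_le_mul_of_nonneg_left h3 (by positivity)).trans (le_of_eq ?_)
  rw [Nat.totient_mul hdq]
  push_cast
  field_simp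

theorem abs_card_modEq_sub_le (N r v : ℕ) (hr : 0 < r) :
    |(((Finset.Ioc 0 N).filter (· ≡ v [MOD r])).card : ℝ) - N / r| ≤ 1 := by
  have h := Nat.Ioc_filter_modEq_card 0 N hr v
  have hmono : ⌊((0 : ℕ) - v : ℚ) / r⌋ ≤ ⌊((N : ℕ) - v : ℚ) / r⌋ := by
    apply Int.floor_le_floor
    gcongr
    simp
  rw [max_eq_left (by linarith)] at h
  have h' : ((((Finset.Ioc 0 N).filter (· ≡ v [MOD r])).card : ℤ) : ℚ)
      = (⌊((N : ℕ) - v : ℚ) / r⌋ : ℚ) - ⌊((0 : ℕ) - v : ℚ) / r⌋ := by exact_mod_cast h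
  have a1 := Int.floor_le (((N : ℕ) - v : ℚ) / r)
  have a2 := Int.lt_floor_add_one (((N : ℕ) - v : ℚ) / r)
  have a3 := Int.floor_le (((0 : ℕ) - v : ℚ) / r)
  have a4 := Int.lt_floor_add_one (((0 : ℕ) - v : ℚ) / r)
  have e : ((N : ℕ) - v : ℚ) / r = N / r + ((0 : ℕ) - v : ℚ) / r := by
    push_cast; ring
  have key : |(((Finset.Ioc 0 N).filter (· ≡ v [MOD r])).card : ℚ) - N / r| ≤ 1 := by
    rw [Int.cast_natCast] at h'
    rw [h', abs_le]
    rw [e] at a1 a2 ⊢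
    constructor <;> linarith
  have hcast := (Rat.cast_le (K := ℝ)).mpr key
  push_cast at hcast
  exact hcast

/-- A form of the **Brun–Titchmarsh inequality**. -/
theorem card_primes_modEq_le {q : ℕ} (hq : q ≠ 0) (a N : ℕ) {z : ℕ} (hz : 1 ≤ z) :
    (((Finset.Ioc 0 N).filter fun p => p.Prime ∧ p ≡ a [MOD q]).card : ℝ) ≤
      N / (q.totient * Real.log (z + 1)) + z ^ 4 + z := by
  set D := squarefreeCoprime q z with hD
  set A := (Finset.Ioc 0 N).filter (· ≡ a [MOD q]) with hAdef
  have hq0 : 0 < q := Nat.pos_of_ne_zero hq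
  have hqR : (0 : ℝ) < q := by exact_mod_cast hq0
  have hφ : (0 : ℝ) < q.totient := by exact_mod_cast Nat.totient_pos.mpr hq0
  have hlog : 0 < Real.log (z + 1) := Real.log_pos (by
    have : (1 : ℝ) ≤ z := by exact_mod_cast hz
    linarith)
  have hsieve := selberg_sieve D A (fun d hd => (mem_squarefreeCoprime.mp hd).2.1)
    (fun d hd k hk => by
      obtain ⟨⟨b1, b2⟩, b3, b4⟩ := mem_squarefreeCoprime.mp hd
      exact mem_squarefreeCoprime.mpr ⟨⟨Nat.pos_of_dvd_of_pos hk b1,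
        (Nat.le_of_dvd b1 hk).trans b2⟩, b3.squarefree_of_dvd hk, b4.coprime_dvd_left hk⟩)
    (mem_squarefreeCoprime.mpr ⟨⟨le_rfl, hz⟩, squarefree_one, Nat.coprime_one_left q⟩)
    (N / q) 1 (by
      intro d₁ hd₁ d₂ hd₂
      obtain ⟨⟨b1, b2⟩, b3, b4⟩ := mem_squarefreeCoprime.mp hd₁
      obtain ⟨⟨c1, c2⟩, c3, c4⟩ := mem_squarefreeCoprime.mp hd₂
      set L := Nat.lcm d₁ d₂
      have hL0 : 0 < L := Nat.lcm_pos b1 c1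
      have hLq : L.Coprime q :=
        (Nat.Coprime.mul_left b4 c4).coprime_dvd_left (Nat.lcm_dvd_mul d₁ d₂)
      obtain ⟨v, hv1, hv2⟩ := Nat.chineseRemainder hLq 0 a
      -- By the Chinese remainder theorem both conditions form one class modulo `L * q`, so the
      -- sieve error `K` is 1.
      have hset : A.filter (L ∣ ·) = (Finset.Ioc 0 N).filter (· ≡ v [MOD L * q]) := by
        ext n
        simp only [hAdef, Finset.mem_filter, ← Nat.modEq_and_modEq_iff_modEq_mul hLq, and_assoc]
        refine and_congr_right fun _ => ⟨fun h => ⟨?_, h.1.trans hv2.symm⟩, fun h =>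
          ⟨h.2.trans hv2, ?_⟩⟩
        · exact ((Nat.modEq_zero_iff_dvd.mpr h.2).trans hv1.symm)
        · exact Nat.modEq_zero_iff_dvd.mp (h.1.trans hv1)
      rw [hset]
      have := abs_card_modEq_sub_le N (L * q) v (Nat.mul_pos hL0 hq0)
      rwa [show ((N : ℝ) / q / L) = N / (L * q : ℕ) by
        push_cast; rw [div_div, mul_comm (q : ℝ)]])
  have hS := log_le_sum_inv_totient hq z
  rw [← hD] at hS
  set S := ∑ d ∈ D, 1 / (d.totient : ℝ)
  have hmain : (N / q : ℝ) / S ≤ N / (q.totient * Real.log (z + 1)) := by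
    have h1 : q.totient * Real.log (z + 1) ≤ q * S := by
      have := mul_le_mul_of_nonneg_left hS hφ.le
      calc _ ≤ _ := this
        _ = q * S := by field_simp
    rw [div_div]
    exact div_le_div_of_nonneg_left (Nat.cast_nonneg N) (by positivity) h1
  have hsum : (∑ d ∈ D, (d : ℝ)) ≤ z ^ 2 := by
    have h1 : ∀ d ∈ D, (d : ℝ) ≤ z := fun d hd => by
      exact_mod_cast (mem_squarefreeCoprime.mp hd).1.2
    have h2 : D.card ≤ z := by
      have := Finset.card_filter_le (Finset.Icc 1 z) fun d => Squarefree d ∧ d.Coprime q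
      rwa [Nat.card_Icc, Nat.add_sub_cancel] at this
    have h3 := Finset.sum_le_card_nsmul D (fun d => (d : ℝ)) z h1
    rw [nsmul_eq_mul] at h3
    calc _ ≤ _ := h3
      _ ≤ (z : ℝ) * z := by gcongr
      _ = (z : ℝ) ^ 2 := by ring
  have herr : 1 * (∑ d ∈ D, (d : ℝ)) ^ 2 ≤ z ^ 4 := by
    have h0 : 0 ≤ ∑ d ∈ D, (d : ℝ) := Finset.sum_nonneg fun _ _ => Nat.cast_nonneg _
    calc 1 * (∑ d ∈ D, (d : ℝ)) ^ 2 ≤ 1 * ((z : ℝ) ^ 2) ^ 2 := by gcongr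
      _ = _ := by ring
  -- A prime above `z` survives the sieve; the integers up to `z` are counted trivially.
  have hsub : ((Finset.Ioc 0 N).filter fun p => p.Prime ∧ p ≡ a [MOD q]) ⊆
      (A.filter (fun n => ∀ d ∈ D, d ∣ n → d = 1)) ∪ Finset.Icc 1 z := by
    intro p hp
    obtain ⟨p1, p2, p3⟩ := Finset.mem_filter.mp hp
    by_cases hpz : p ≤ z
    · exact Finset.mem_union_right _ (Finset.mem_Icc.mpr ⟨p2.one_le, hpz⟩)
    · refine Finset.mem_union_left _ (Finset.mem_filter.mpr
        ⟨Finset.mem_filter.mpr ⟨p1, p3⟩, fun d hd hdp => ?_⟩)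
      rcases (Nat.dvd_prime p2).mp hdp with h | h
      · exact h
      · exact absurd (h ▸ (mem_squarefreeCoprime.mp hd).1.2) hpz
  have hcard : (((Finset.Ioc 0 N).filter fun p => p.Prime ∧ p ≡ a [MOD q]).card : ℝ) ≤
      (A.filter (fun n => ∀ d ∈ D, d ∣ n → d = 1)).card + z := by
    have := (Finset.card_le_card hsub).trans (Finset.card_union_le _ _)
    rw [Nat.card_Icc, Nat.add_sub_cancel] at this
    exact_mod_cast this
  linarith

/-! ### Fermat numbers modulo an elite prime -/

theorem IsElitePrime.odd {p : ℕ} (h : IsElitePrime p) : Odd p := by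
  refine h.1.odd_of_ne_two ?_
  rintro rfl
  obtain ⟨n, hn⟩ := h.2.exists
  exact hn (by generalize ((Nat.fermatNumber n : ℕ) : ZMod 2) = a; revert a; decide)

/-- The sequence of Fermat numbers modulo an odd prime `p` is periodic from the index given by the
`2`-adic valuation of `p - 1`. -/
theorem exists_fermatNumber_cast_eq {p e n : ℕ} (hp : p.Prime) (hodd : Odd p)
    (he : ¬ 2 ^ e ∣ p - 1) (hn : e ≤ n) (m₀ : ℕ) :
    ∃ m ≥ m₀, ((Nat.fermatNumber m : ℕ) : ZMod p) = (Nat.fermatNumber n : ℕ) := by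
  have : Fact p.Prime := ⟨hp⟩
  have hp1 : p - 1 ≠ 0 := by have := hp.two_le; omega
  obtain ⟨v, k, hk, hvk⟩ := Nat.exists_eq_two_pow_mul_odd hp1
  have hve : v < e := by
    by_contra hlt
    exact he (hvk ▸ (pow_dvd_pow 2 (not_lt.mp hlt)).mul_right k)
  obtain ⟨c, rfl⟩ := Nat.exists_eq_add_of_le (hve.le.trans hn)
  have hφ : 0 < k.totient := Nat.totient_pos.mpr hk.pos
  -- With $p-1 = 2^v k$, $k$ odd, the powers $2^m$ modulo $p-1$ have period $\varphi(k)$ once $m \ge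
  -- v$; here `n = v + c`.
  refine ⟨v + c + m₀ * k.totient, ?_, ?_⟩
  · exact (Nat.le_mul_of_pos_right m₀ hφ).trans (Nat.le_add_left _ _)
  · have h1 : (2 ^ k.totient) ^ m₀ ≡ 1 ^ m₀ [MOD k] :=
      (Nat.ModEq.pow_totient (Nat.coprime_two_left.mpr hk)).pow m₀
    have h2 : 2 ^ (v + c + m₀ * k.totient) ≡ 2 ^ (v + c) [MOD p - 1] := by
      rw [hvk]
      have h3 := (h1.mul_left (2 ^ c)).mul_left' (2 ^ v)
      rw [one_pow, mul_one, ← pow_mul, ← pow_add, ← pow_add, ← pow_add] at h3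
      rwa [show v + c + m₀ * k.totient = v + (c + k.totient * m₀) by ring]
    have h20 : (2 : ZMod p) ≠ 0 := by
      intro h0
      have : ((2 : ℕ) : ZMod p) = 0 := by exact_mod_cast h0
      rw [ZMod.natCast_eq_zero_iff] at this
      have h4 := (Nat.prime_dvd_prime_iff_eq hp Nat.prime_two).mp this
      subst h4
      exact absurd hodd (by decide)
    have h5 : (2 : ZMod p) ^ 2 ^ (v + c + m₀ * k.totient) = 2 ^ 2 ^ (v + c) :=
      pow_eq_pow_of_modEq h2 (ZMod.pow_card_sub_one_eq_one h20)
    simp only [Nat.fermatNumber, Nat.cast_add, Nat.cast_pow, Nat.cast_ofNat, Nat.cast_one, h5]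

/-- The value at `n` recurs at arbitrarily large indices, so the unspecified threshold in the
definition can be replaced by `e`. -/
theorem IsElitePrime.not_isSquare {p e n : ℕ} (h : IsElitePrime p) (he : ¬ 2 ^ e ∣ p - 1)
    (hn : e ≤ n) : ¬ IsSquare ((Nat.fermatNumber n : ℕ) : ZMod p) := by
  obtain ⟨m₀, hm₀⟩ := eventually_atTop.mp h.2
  obtain ⟨m, hm, hmn⟩ := exists_fermatNumber_cast_eq h.1 h.odd he hn m₀
  exact hmn ▸ hm₀ m hm

theorem fermatNumber_mod_four {n : ℕ} (hn : n ≠ 0) : Nat.fermatNumber n % 4 = 1 := by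
  obtain ⟨m, rfl⟩ := Nat.exists_eq_succ_of_ne_zero hn
  have h2 : 2 ^ (m + 1) = 2 + (2 ^ (m + 1) - 2) := by
    have : 2 ≤ 2 ^ (m + 1) := by
      rw [pow_succ]
      have := Nat.one_le_two_pow (n := m)
      omega
    omega
  rw [Nat.fermatNumber, Nat.succ_eq_add_one, h2, pow_add]
  omega

theorem fermatNumber_mod_three {n : ℕ} (hn : n ≠ 0) : Nat.fermatNumber n % 3 = 2 := by
  obtain ⟨m, rfl⟩ := Nat.exists_eq_succ_of_ne_zero hn
  rw [Nat.fermatNumber, Nat.succ_eq_add_one, pow_succ', pow_mul, Nat.add_mod, Nat.pow_mod]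
  norm_num

/-- `3` is a witness that the Jacobi symbol modulo a Fermat number takes the value `-1`. -/
theorem jacobiSym_three_fermatNumber {n : ℕ} (hn : n ≠ 0) :
    jacobiSym 3 (Nat.fermatNumber n) = -1 := by
  have h := jacobiSym.quadratic_reciprocity_one_mod_four (fermatNumber_mod_four hn)
    (b := 3) (by decide)
  rw [Nat.cast_ofNat] at h
  rw [← h, jacobiSym.mod_left]
  have : ((Nat.fermatNumber n : ℕ) : ℤ) % ((3 : ℕ) : ℤ) = 2 := by
    exact_mod_cast fermatNumber_mod_three hn
  rw [this, jacobiSym.at_two (by decide)]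
  decide

/-- Reciprocity turns a condition modulo the varying prime `p` into one on the class of `p` modulo a
fixed number, which a sieve can use. -/
theorem IsElitePrime.jacobiSym_fermatNumber {p e n : ℕ} (h : IsElitePrime p)
    (he : ¬ 2 ^ e ∣ p - 1) (hn : e ≤ n) (hn0 : n ≠ 0) :
    jacobiSym p (Nat.fermatNumber n) = -1 := by
  have : Fact p.Prime := ⟨h.1⟩
  rw [← jacobiSym.quadratic_reciprocity_one_mod_four (fermatNumber_mod_four hn0) h.odd,
    ZMod.nonsquare_iff_jacobiSym_eq_neg_one]
  exact_mod_cast h.not_isSquare he hn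

/-! ### Counting the admissible residue classes -/

/-- The residues modulo `F` with Jacobi symbol `-1`. -/
def jacobiNonresidues (F : ℕ) [NeZero F] : Finset (ZMod F) :=
  Finset.univ.filter fun a => jacobiSym a.val F = -1

theorem jacobiSym_val_natCast (F a : ℕ) :
    jacobiSym ((a : ZMod F).val : ℕ) F = jacobiSym a F := by
  rw [ZMod.val_natCast, Int.natCast_mod, ← jacobiSym.mod_left]

theorem jacobiSym_val_mul (F : ℕ) [NeZero F] (a b : ZMod F) :
    jacobiSym ((a * b).val : ℕ) F = jacobiSym (a.val : ℕ) F * jacobiSym (b.val : ℕ) F := by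
  rw [ZMod.val_mul, Int.natCast_mod, ← jacobiSym.mod_left, Nat.cast_mul, jacobiSym.mul_left]

/-- Multiplication by `u` injects the residues of symbol $-1$ into those of symbol $1$, and both
sets consist of units. -/
theorem two_mul_card_jacobiNonresidues_le {F : ℕ} [NeZero F] {u : ℕ}
    (hu : jacobiSym u F = -1) : 2 * (jacobiNonresidues F).card ≤ F.totient := by
  set P : Finset (ZMod F) := Finset.univ.filter fun a => jacobiSym a.val F = 1 with hP
  set R := jacobiNonresidues F with hR
  have huF : u.Coprime F := by
    by_contra hc
    have : jacobiSym u F = 0 := jacobiSym.eq_zero_iff_not_coprime.mpr (by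
      rwa [Int.gcd_natCast_natCast])
    rw [this] at hu
    norm_num at hu
  have hinj : Function.Injective fun a : ZMod F => (u : ZMod F) * a :=
    ((ZMod.isUnit_iff_coprime u F).mpr huF).mul_right_injective
  have hle : R.card ≤ P.card := by
    refine Finset.card_le_card_of_injOn (fun a => (u : ZMod F) * a) (fun a ha => ?_) hinj.injOn
    have ha' : jacobiSym a.val F = -1 := (Finset.mem_filter.mp ha).2
    simp only [hP, Finset.coe_filter, Finset.mem_univ, true_and, Set.mem_ofPred_eq]
    rw [jacobiSym_val_mul, jacobiSym_val_natCast, hu, ha']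
    norm_num
  have hdisj : Disjoint R P := by
    rw [Finset.disjoint_left]
    intro a h1 h2
    have h1' : jacobiSym a.val F = -1 := (Finset.mem_filter.mp h1).2
    have h2' : jacobiSym a.val F = 1 := (Finset.mem_filter.mp h2).2
    rw [h1'] at h2'
    norm_num at h2'
  have hsub : R ∪ P ⊆ Finset.univ.image ((↑) : (ZMod F)ˣ → ZMod F) := by
    intro a ha
    have ha0 : jacobiSym a.val F ≠ 0 := by
      rcases Finset.mem_union.mp ha with h | h
      · have h' : jacobiSym a.val F = -1 := (Finset.mem_filter.mp h).2
        rw [h']; norm_num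
      · rw [(Finset.mem_filter.mp h).2]; norm_num
    have hco : a.val.Coprime F := by
      by_contra hc
      exact ha0 (jacobiSym.eq_zero_iff_not_coprime.mpr (by rwa [Int.gcd_natCast_natCast]))
    have := (ZMod.isUnit_iff_coprime a.val F).mpr hco
    rw [ZMod.natCast_zmod_val] at this
    obtain ⟨w, hw⟩ := this
    exact Finset.mem_image.mpr ⟨w, Finset.mem_univ _, hw⟩
  have h1 := Finset.card_le_card hsub
  rw [Finset.card_union_of_disjoint hdisj] at h1
  have h2 := h1.trans Finset.card_image_le
  rw [Finset.card_univ, ZMod.card_units_eq_totient] at h2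
  omega

theorem totient_prod_of_pairwise_coprime {ι : Type*} (s : Finset ι) (a : ι → ℕ)
    (h : Pairwise (Function.onFun Nat.Coprime a)) :
    (∏ i ∈ s, a i).totient = ∏ i ∈ s, (a i).totient := by
  classical
  induction s using Finset.induction_on with
  | empty => simp
  | insert i s hi ih =>
    rw [Finset.prod_insert hi, Finset.prod_insert hi, Nat.totient_mul, ih]
    exact Nat.Coprime.prod_right fun j hj => h (by rintro rfl; exact hi hj)

instance neZero_fermatNumber (n : ℕ) : NeZero (Nat.fermatNumber n) :=
  ⟨by have := Nat.three_le_fermatNumber n; omega⟩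

/-- There are few residue classes modulo `F_e ⋯ F_{N-1}` whose Jacobi symbols at all the factors
are `-1`. -/
theorem exists_residues {e : ℕ} (he : e ≠ 0) (N : ℕ) :
    ∃ q : ℕ, q ≠ 0 ∧ q ≤ 2 ^ 2 ^ N ∧ ∃ Q : Finset ℕ, 2 ^ (N - e) * Q.card ≤ q.totient ∧
      ∀ p, IsElitePrime p → ¬ 2 ^ e ∣ p - 1 → ∃ b ∈ Q, p ≡ b [MOD q] := by
  classical
  let ι := Finset.Ico e N
  let a : ι → ℕ := fun i => Nat.fermatNumber i
  have hco : Pairwise (Function.onFun Nat.Coprime a) := fun i j hij =>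
    Nat.coprime_fermatNumber_fermatNumber fun h => hij (Subtype.ext h)
  -- Index 0 must be avoided: $F_0 = 3$ is not 1 modulo 4 and is not coprime to the witness 3.
  have hi0 : ∀ i : ι, (i : ℕ) ≠ 0 := fun i => by
    have := (Finset.mem_Ico.mp i.2).1
    omega
  have hq0 : ∏ i, a i ≠ 0 := Finset.prod_ne_zero_iff.mpr fun i _ => NeZero.ne _
  have : NeZero (∏ i, a i) := ⟨hq0⟩
  let φ := ZMod.prodEquivPi a hco
  let R : Finset ((i : ι) → ZMod (a i)) := Fintype.piFinset fun i => jacobiNonresidues (a i)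
  refine ⟨∏ i, a i, hq0, ?_, R.image fun b => (φ.symm b).val, ?_, ?_⟩
  · have h1 : ∏ i, a i = ∏ i ∈ Finset.Ico e N, Nat.fermatNumber i :=
      Finset.prod_coe_sort (Finset.Ico e N) Nat.fermatNumber
    have h2 : ∏ i ∈ Finset.Ico e N, Nat.fermatNumber i ≤ ∏ i ∈ Finset.range N, Nat.fermatNumber i :=
      Finset.prod_le_prod_of_subset_of_one_le' (fun i hi =>
        Finset.mem_range.mpr (Finset.mem_Ico.mp hi).2)
        fun i _ _ => (Nat.three_le_fermatNumber i).trans' (by norm_num)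
    -- $F_0 \cdots F_{N-1} = F_N - 2 = 2^{2^N} - 1$.
    rw [Nat.prod_fermatNumber, Nat.fermatNumber] at h2
    rw [h1]
    omega
  · calc 2 ^ (N - e) * (R.image fun b => (φ.symm b).val).card ≤ 2 ^ (N - e) * R.card :=
          Nat.mul_le_mul_left _ Finset.card_image_le
      _ = ∏ i : ι, 2 * (jacobiNonresidues (a i)).card := by
          rw [Finset.prod_mul_distrib, Fintype.card_piFinset, Finset.prod_const, Finset.card_univ,
            Fintype.card_coe, Nat.card_Ico]
      _ ≤ ∏ i : ι, (a i).totient := Finset.prod_le_prod' fun i _ =>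
          two_mul_card_jacobiNonresidues_le (u := 3)
            (by exact_mod_cast jacobiSym_three_fermatNumber (hi0 i))
      _ = (∏ i, a i).totient := (totient_prod_of_pairwise_coprime _ a hco).symm
  · intro p hp hpe
    refine ⟨((p : ZMod (∏ i, a i))).val, Finset.mem_image.mpr ⟨φ p, ?_, by rw [φ.symm_apply_apply]⟩, ?_⟩
    · refine Fintype.mem_piFinset.mpr fun i => Finset.mem_filter.mpr ⟨Finset.mem_univ _, ?_⟩
      rw [map_natCast, Pi.natCast_apply, jacobiSym_val_natCast]
      exact hp.jacobiSym_fermatNumber hpe (Finset.mem_Ico.mp i.2).1 (hi0 i)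
    · rw [ZMod.val_natCast]
      exact (Nat.mod_modEq _ _).symm

/-! ### The bound for the counting function -/

/-- The first term comes from $2^e \mid p-1$, the second from the other elite primes. The last
collects the sieve errors of all the classes, whose number is at most $1 + 2^{2^N}$. -/
theorem card_elitePrimes_le {e N z : ℕ} (he : e ≠ 0) (hz : 1 ≤ z) (M : ℕ)
    (s : Finset ℕ) (hs : ∀ p ∈ s, IsElitePrime p ∧ p ≤ M) :
    (s.card : ℝ) ≤ M / (2 ^ (e - 1) * Real.log (z + 1)) + M / (2 ^ (N - e) * Real.log (z + 1)) +
      (1 + 2 ^ 2 ^ N) * (z ^ 4 + z) := by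
  classical
  obtain ⟨q, hq0, hqN, Q, hQ, hres⟩ := exists_residues he N
  let C : ℕ → ℕ → Finset ℕ := fun r b =>
    (Finset.Ioc 0 M).filter fun p => p.Prime ∧ p ≡ b [MOD r]
  have hsub : s ⊆ C (2 ^ e) 1 ∪ Q.biUnion (C q) := by
    intro p hp
    obtain ⟨hel, hpM⟩ := hs p hp
    have hIoc : p ∈ Finset.Ioc 0 M := Finset.mem_Ioc.mpr ⟨hel.1.pos, hpM⟩
    by_cases hpe : 2 ^ e ∣ p - 1
    · exact Finset.mem_union_left _ (Finset.mem_filter.mpr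
        ⟨hIoc, hel.1, ((Nat.modEq_iff_dvd' hel.1.one_le).mpr hpe).symm⟩)
    · obtain ⟨b, hb, hpb⟩ := hres p hel hpe
      exact Finset.mem_union_right _ (Finset.mem_biUnion.mpr
        ⟨b, hb, Finset.mem_filter.mpr ⟨hIoc, hel.1, hpb⟩⟩)
  have hlog : 0 < Real.log (z + 1) := Real.log_pos (by
    have : (1 : ℝ) ≤ z := by exact_mod_cast hz
    linarith)
  have hcard : (s.card : ℝ) ≤ (C (2 ^ e) 1).card + ∑ b ∈ Q, ((C q b).card : ℝ) := by
    have h1 := (Finset.card_le_card hsub).trans (Finset.card_union_le _ _)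
    have h2 : (Q.biUnion (C q)).card ≤ ∑ b ∈ Q, (C q b).card := Finset.card_biUnion_le
    exact_mod_cast h1.trans (Nat.add_le_add_left h2 _)
  have h1 : ((C (2 ^ e) 1).card : ℝ) ≤ M / (2 ^ (e - 1) * Real.log (z + 1)) + (z ^ 4 + z) := by
    have := card_primes_modEq_le (pow_ne_zero e two_ne_zero) 1 M hz
    rw [Nat.totient_prime_pow Nat.prime_two (Nat.pos_of_ne_zero he)] at this
    norm_num at this
    linarith
  have hφ : (0 : ℝ) < q.totient := by
    exact_mod_cast Nat.totient_pos.mpr (Nat.pos_of_ne_zero hq0)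
  have hQR : (2 : ℝ) ^ (N - e) * Q.card ≤ q.totient := by exact_mod_cast hQ
  have hQN : (Q.card : ℝ) ≤ 2 ^ 2 ^ N := by
    have h3 : Q.card ≤ 2 ^ (N - e) * Q.card := Nat.le_mul_of_pos_left _ (by positivity)
    exact_mod_cast (h3.trans hQ).trans ((Nat.totient_le q).trans hqN)
  have h2 : ∑ b ∈ Q, ((C q b).card : ℝ) ≤
      M / (2 ^ (N - e) * Real.log (z + 1)) + 2 ^ 2 ^ N * (z ^ 4 + z) := by
    have h3 := Finset.sum_le_card_nsmul Q (fun b => ((C q b).card : ℝ)) _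
      fun b _ => card_primes_modEq_le hq0 b M hz
    rw [nsmul_eq_mul] at h3
    refine h3.trans ?_
    have h4 : (Q.card : ℝ) * (M / (q.totient * Real.log (z + 1))) ≤
        M / (2 ^ (N - e) * Real.log (z + 1)) := by
      rw [mul_div_assoc', div_le_div_iff₀ (by positivity) (by positivity)]
      have : (0 : ℝ) ≤ M * Real.log (z + 1) := by positivity
      nlinarith [mul_le_mul_of_nonneg_left hQR this]
    have h5 : (Q.card : ℝ) * (z ^ 4 + z) ≤ 2 ^ 2 ^ N * (z ^ 4 + z) := by gcongr
    linarith
  linarith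

theorem finite_elitePrimes_le (x : ℝ) : {p : ℕ | IsElitePrime p ∧ (p : ℝ) ≤ x}.Finite :=
  (Set.finite_Iic ⌊x⌋₊).subset fun _ hp => Nat.le_floor hp.2

theorem exists_four_pow_le {y : ℝ} (hy : 4 ≤ y) :
    ∃ e : ℕ, e ≠ 0 ∧ (4 : ℝ) ^ e ≤ y ∧ y < 4 ^ (e + 1) := by
  have hf : 4 ≤ ⌊y⌋₊ := Nat.le_floor (by exact_mod_cast hy)
  refine ⟨Nat.log 4 ⌊y⌋₊, (Nat.log_pos (by norm_num) hf).ne', ?_, ?_⟩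
  · have h1 := Nat.pow_log_le_self 4 (show ⌊y⌋₊ ≠ 0 by omega)
    have h2 : ((4 ^ Nat.log 4 ⌊y⌋₊ : ℕ) : ℝ) ≤ ⌊y⌋₊ := by exact_mod_cast h1
    push_cast at h2
    exact h2.trans (Nat.floor_le (by linarith))
  · have h1 := Nat.lt_pow_succ_log_self (show 1 < 4 by norm_num) ⌊y⌋₊
    have h2 : ((⌊y⌋₊ + 1 : ℕ) : ℝ) ≤ ((4 ^ (Nat.log 4 ⌊y⌋₊ + 1) : ℕ) : ℝ) := by exact_mod_cast h1
    push_cast at h2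
    exact (Nat.lt_floor_add_one y).trans_le h2

/-- Take $4^e \le \frac14 \log x < 4^{e+1}$, $N = 2e$ and $z = \lfloor x^{1/16} \rfloor$. Then
$2^{2^N} \le x^{1/4}$ and $z^4 \le x^{1/4}$, so the errors are $O(x^{1/2})$. -/
theorem eliteCount_le {x : ℝ} (hx0 : 0 < x) (hx : 16 ≤ Real.log x) :
    (eliteCount x : ℝ) ≤ 192 * (x / (Real.log x) ^ (3 / 2 : ℝ)) + 4 * x ^ (1 / 2 : ℝ) := by
  set L := Real.log x with hL
  have hx1 : 1 ≤ x := by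
    by_contra h
    have := Real.log_nonpos hx0.le (not_le.mp h).le
    linarith
  obtain ⟨e, he0, he1, he2⟩ := exists_four_pow_le (y := L / 4) (by linarith)
  set w : ℝ := x ^ (1 / 16 : ℝ) with hw
  have hw1 : 1 ≤ w := Real.one_le_rpow hx1 (by norm_num)
  set z := ⌊w⌋₊ with hz
  have hz1 : 1 ≤ z := Nat.le_floor (by exact_mod_cast hw1)
  have hzw : (z : ℝ) ≤ w := Nat.floor_le (by linarith)
  have hlogz : L / 16 ≤ Real.log (z + 1) := by
    have h1 : Real.log w = L / 16 := by rw [hw, Real.log_rpow hx0]; ring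
    rw [← h1]
    exact Real.log_le_log (by linarith) (Nat.lt_floor_add_one w).le
  obtain ⟨s, hmem⟩ : ∃ s : Finset ℕ, (∀ p, p ∈ s ↔ IsElitePrime p ∧ (p : ℝ) ≤ x) :=
    ⟨(finite_elitePrimes_le x).toFinset, fun p => by simp⟩
  have hcount : eliteCount x = s.card := by
    rw [eliteCount, ← Set.ncard_coe_finset]
    congr 1
    ext p
    simp [hmem]
  have hmain := card_elitePrimes_le (N := 2 * e) he0 hz1 ⌊x⌋₊ s
    fun p hp => ⟨((hmem p).mp hp).1, Nat.le_floor ((hmem p).mp hp).2⟩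
  rw [← hcount] at hmain
  have hMx : (⌊x⌋₊ : ℝ) ≤ x := Nat.floor_le hx0.le
  have hL0 : 0 < L := by linarith
  have hsqrt : Real.sqrt L ≤ 4 * 2 ^ e := by
    rw [Real.sqrt_le_left (by positivity)]
    have : (4 : ℝ) ^ e = (2 ^ e) ^ 2 := by
      rw [show (4 : ℝ) = 2 ^ 2 by norm_num, ← pow_mul, ← pow_mul, mul_comm]
    rw [pow_succ, this] at he2
    nlinarith
  -- $64 = 4 \cdot 16$, from `hsqrt` and `hlogz`. The two main terms then give $128 + 64 = 192$.
  have hden : L ^ (3 / 2 : ℝ) ≤ 64 * (2 ^ e * Real.log (z + 1)) := by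
    have h1 : L ^ (3 / 2 : ℝ) = Real.sqrt L * L := by
      rw [Real.sqrt_eq_rpow, ← Real.rpow_add_one hL0.ne']
      norm_num
    rw [h1]
    calc Real.sqrt L * L ≤ (4 * 2 ^ e) * (16 * Real.log (z + 1)) := by
          gcongr
          linarith
      _ = _ := by ring
  have hLp : 0 < L ^ (3 / 2 : ℝ) := Real.rpow_pos_of_pos hL0 _
  have hlz : 0 < Real.log (z + 1) := by linarith
  have hterm : (⌊x⌋₊ : ℝ) / (2 ^ e * Real.log (z + 1)) ≤ 64 * (x / L ^ (3 / 2 : ℝ)) := by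
    rw [mul_div_assoc', div_le_div_iff₀ (by positivity) hLp]
    calc (⌊x⌋₊ : ℝ) * L ^ (3 / 2 : ℝ) ≤ x * (64 * (2 ^ e * Real.log (z + 1))) := by gcongr
      _ = _ := by ring
  have ht1 : (⌊x⌋₊ : ℝ) / (2 ^ (e - 1) * Real.log (z + 1)) ≤ 128 * (x / L ^ (3 / 2 : ℝ)) := by
    have : (2 : ℝ) ^ e = 2 ^ (e - 1) * 2 := by
      rw [← pow_succ, Nat.sub_add_cancel (Nat.one_le_iff_ne_zero.mpr he0)]
    rw [this] at hterm
    have h2 : (⌊x⌋₊ : ℝ) / (2 ^ (e - 1) * Real.log (z + 1))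
        = 2 * (⌊x⌋₊ / (2 ^ (e - 1) * 2 * Real.log (z + 1))) := by field_simp
    rw [h2]
    linarith
  have hpow : (2 : ℝ) ^ 2 ^ (2 * e) ≤ x ^ (1 / 4 : ℝ) := by
    have h1 : (2 : ℝ) ^ 2 ^ (2 * e) ≤ Real.exp 1 ^ 2 ^ (2 * e) := by
      gcongr
      have := Real.add_one_le_exp 1
      linarith
    refine h1.trans ?_
    rw [← Real.exp_nat_mul, Real.rpow_def_of_pos hx0, Real.exp_le_exp, pow_mul]
    push_cast
    norm_num
    linarith
  have hv1 : 1 ≤ x ^ (1 / 4 : ℝ) := Real.one_le_rpow hx1 (by norm_num)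
  have hw4 : w ^ 4 = x ^ (1 / 4 : ℝ) := by
    rw [hw, ← Real.rpow_natCast, ← Real.rpow_mul hx0.le]
    norm_num
  have hz4 : (z : ℝ) ^ 4 + z ≤ 2 * x ^ (1 / 4 : ℝ) := by
    have h1 : (z : ℝ) ^ 4 ≤ w ^ 4 := by gcongr
    have h2 : w ≤ w ^ 4 := le_self_pow₀ hw1 (by norm_num)
    linarith
  have herr : (1 + (2 : ℝ) ^ 2 ^ (2 * e)) * ((z : ℝ) ^ 4 + z) ≤ 4 * x ^ (1 / 2 : ℝ) := by
    have h1 : x ^ (1 / 2 : ℝ) = x ^ (1 / 4 : ℝ) * x ^ (1 / 4 : ℝ) := by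
      rw [← Real.rpow_add hx0]; norm_num
    rw [h1]
    calc (1 + (2 : ℝ) ^ 2 ^ (2 * e)) * ((z : ℝ) ^ 4 + z)
        ≤ (2 * x ^ (1 / 4 : ℝ)) * (2 * x ^ (1 / 4 : ℝ)) := by
          gcongr
          linarith
      _ = _ := by ring
  rw [show 2 * e - e = e by omega] at hmain
  linarith

theorem eliteCount_isBigO : (fun x : ℝ => (eliteCount x : ℝ)) =O[atTop]
    fun x : ℝ => x / (Real.log x) ^ (3 / 2 : ℝ) := by
  have h1 : (fun x : ℝ => x ^ (1 / 2 : ℝ)) =O[atTop]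
      fun x : ℝ => x / (Real.log x) ^ (3 / 2 : ℝ) := by
    have h2 := (isLittleO_log_rpow_rpow_atTop (3 / 2) (show (0 : ℝ) < 1 / 2 by norm_num)).isBigO
    have h3 := (h2.inv_rev ?_).mul (isBigO_refl (fun x : ℝ => x) atTop)
    · refine h3.congr' ?_ ?_
      · filter_upwards [eventually_gt_atTop 0] with x hx
        rw [← Real.rpow_neg hx.le, ← Real.rpow_add_one hx.ne']
        norm_num
      · filter_upwards with x
        exact inv_mul_eq_div _ _
    · filter_upwards [eventually_gt_atTop 1] with x hx h0
      exact absurd h0 (Real.rpow_pos_of_pos (Real.log_pos hx) _).ne'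
  refine IsBigO.trans ?_ (((isBigO_refl _ _).const_mul_left 192).add (h1.const_mul_left 4))
  refine IsBigO.of_bound 1 ?_
  filter_upwards [Real.tendsto_log_atTop.eventually_ge_atTop 16, eventually_gt_atTop 0] with x hx hx0
  rw [one_mul, Real.norm_natCast]
  exact (eliteCount_le hx0 hx).trans (Real.le_norm_self _)

/-! ### Convergence of the sum of reciprocals -/

/-- The elite primes in $[2^k, 2^{k+1})$ contribute at most $E(2^{k+1})/2^k = O((k+1)^{-3/2})$,
which is summable over $k$. -/
theorem summable_one_div_of_eliteCount_isBigO
    (h : (fun x : ℝ => (eliteCount x : ℝ)) =O[atTop]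
      fun x : ℝ => x / (Real.log x) ^ (3 / 2 : ℝ)) :
    Summable (fun p : {p : ℕ // IsElitePrime p} => 1 / ((p : ℕ) : ℝ)) := by
  let c : ℕ → ℝ := fun k => eliteCount (2 ^ (k + 1)) / 2 ^ k
  have hc0 : ∀ k, 0 ≤ c k := fun k => by positivity
  have hc : Summable c := by
    have h1 : Summable fun k : ℕ => ((k + 1 : ℕ) : ℝ) ^ (-(3 / 2) : ℝ) :=
      (summable_nat_add_iff 1).mpr (Real.summable_nat_rpow.mpr (by norm_num))
    refine summable_of_isBigO_nat h1 ?_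
    have ht : Tendsto (fun k : ℕ => (2 : ℝ) ^ (k + 1)) atTop atTop :=
      (tendsto_pow_atTop_atTop_of_one_lt (by norm_num)).comp (tendsto_add_atTop_nat 1)
    have h2 := (h.comp_tendsto ht).mul (isBigO_refl (fun k : ℕ => ((2 : ℝ) ^ k)⁻¹) atTop)
    have h3 := (isBigO_refl (fun k : ℕ => ((k + 1 : ℕ) : ℝ) ^ (-(3 / 2) : ℝ)) atTop).const_mul_left
      (2 / (Real.log 2) ^ (3 / 2 : ℝ))
    refine (h2.congr (fun k => ?_) fun k => ?_).trans h3
    · simp only [c, Function.comp, div_eq_mul_inv]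
    · have hl : 0 < Real.log 2 := Real.log_pos (by norm_num)
      simp only [Function.comp]
      rw [Real.log_pow, Real.mul_rpow (by positivity) hl.le, Real.rpow_neg (by positivity),
        pow_succ]
      have : (0 : ℝ) < ((k + 1 : ℕ) : ℝ) ^ (3 / 2 : ℝ) := by positivity
      have := Real.rpow_pos_of_pos hl (3 / 2)
      field_simp
  refine summable_of_sum_le (c := ∑' k, c k) (fun p => by positivity) fun s => ?_
  let g : {p : ℕ // IsElitePrime p} → ℕ := fun p => Nat.log 2 p
  rw [← Finset.sum_fiberwise_of_maps_to (t := s.image g) fun p hp => Finset.mem_image_of_mem g hp]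
  refine (Finset.sum_le_sum fun k _ => ?_).trans (hc.sum_le_tsum (s.image g) fun k _ => hc0 k)
  have hb : ∀ p ∈ s.filter (g · = k), (1 / ((p : ℕ) : ℝ)) ≤ 1 / 2 ^ k := by
    intro p hp
    have h1 : 2 ^ k ≤ (p : ℕ) :=
      (Finset.mem_filter.mp hp).2 ▸ Nat.pow_log_le_self 2 p.2.1.ne_zero
    have h2 : (2 : ℝ) ^ k ≤ (p : ℕ) := by exact_mod_cast h1
    exact one_div_le_one_div_of_le (by positivity) h2
  have hcard : (s.filter (g · = k)).card ≤ eliteCount (2 ^ (k + 1)) := by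
    rw [eliteCount, ← Finset.card_map (Function.Embedding.subtype IsElitePrime),
      ← Set.ncard_coe_finset]
    refine Set.ncard_le_ncard (fun p hp => ?_) (finite_elitePrimes_le _)
    obtain ⟨⟨p', hp'⟩, hp1, rfl⟩ := Finset.mem_map.mp hp
    refine ⟨hp', ?_⟩
    have h1 : p' < 2 ^ (k + 1) :=
      (Finset.mem_filter.mp hp1).2 ▸ Nat.lt_pow_succ_log_self (by norm_num) p'
    change ((p' : ℕ) : ℝ) ≤ 2 ^ (k + 1)
    exact_mod_cast h1.le
  refine (Finset.sum_le_card_nsmul _ _ _ hb).trans ?_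
  rw [nsmul_eq_mul, mul_one_div]
  exact div_le_div_of_nonneg_right (by exact_mod_cast hcard) (by positivity)

theorem theorem1 :
    ((fun x : ℝ => (eliteCount x : ℝ)) =O[atTop]
      fun x : ℝ => x / (Real.log x) ^ (3 / 2 : ℝ)) ∧
    Summable (fun p : {p : ℕ // IsElitePrime p} => 1 / ((p : ℕ) : ℝ)) :=
  ⟨eliteCount_isBigO, summable_one_div_of_eliteCount_isBigO eliteCount_isBigO⟩
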